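/- Let $G=(V,E)$ be a finite undirected simple graph, with $N(i)$ the set of neighbours of $i$, and let $f(x)=\tfrac12 x^\top\Gamma x-h^\top x$ on $\mathbb{R}^V$, where $\Gamma$ is a real symmetric positive definite matrix and $h\in\mathbb{R}^V$. "Quadratic" means polynomial of degree at most two. A decomposition of $f$ into quadratic functions is a family of quadratic functions $f_i:\mathbb{R}\to\mathbb{R}$ ($i\in V$) and $f_{ij}:\mathbb{R}^2\to\mathbb{R}$ ($(i,j)\in E$, with $f_{ij}(x_i,x_j)=f_{ji}(x_j,x_i)$) such that $f(x)=\sum_{i\in V}f_i(x_i)+\sum_{(i,j)\in E}f_{ij}(x_i,x_j)$ for all $x$, each undirected edge being counted once. It is a convex decomposition if moreover every $f_i$ is strictly convex and every $f_{ij}$ is convex. Given a decomposition $\{f_i,f_{ij}\}$, initial messages $J^{(0)}_{i\to j}:\mathbb{R}\to\mathbb{R}$ for all ordered pairs of adjacent vertices, and arbitrary real offsets $\kappa^{(t)}_{ij}$, the min-sum algorithm computes $$J^{(t+1)}_{i\to j}(x_j)=\kappa^{(t)}_{ij}+\min_{y_i\in\mathbb{R}}\Big(f_i(y_i)+f_{ij}(y_i,x_j)+\sum_{u\in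 N(i)\setminus\{j\}}J^{(t)}_{u\to i}(y_i)\Big),\qquad t\ge 0,$$ and the running estimates $$x^{(t)}_j=\operatorname*{argmin}_{y_j\in\mathbb{R}}\Big(f_j(y_j)+\sum_{i\in N(j)}J^{(t)}_{i\to j}(y_j)\Big).$$ Let $\{g_i,g_{ij}\}$ be a convex decomposition of $f$, let $\{f_i,f_{ij}\}$ be a decomposition of $f$ into quadratic functions, and let the initial messages $J^{(0)}_{i\to j}$ be quadratic. Suppose that for every edge $(i,j)\in E$ the function $$(x_i,x_j)\mapsto g_{ij}(x_i,x_j)+J^{(0)}_{i\to j}(x_j)+J^{(0)}_{j\to i}(x_i)-f_{ij}(x_i,x_j)$$ is convex on $\mathbb{R}^2$. Then the min-sum algorithm using $\{f_i,f_{ij}\}$ and $\{J^{(0)}_{i\to j}\}$ is well defined for every choice of the offsets (all the minima in the message updates are attained, and every $x^{(t)}_j$ exists and is unique), the running estimates $x^{(t)}$ converge as $t\to\infty$, and $$\lim_{t\to\infty}f(x^{(t)})=\min_{x}f(x).$$ -/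

import Mathlib

open Filter Topology

namespace MinSum

/-- A (possibly degenerate) quadratic function of one real variable. -/
def IsQuadratic (φ : ℝ → ℝ) : Prop :=
  ∃ a b c : ℝ, ∀ x, φ x = a * x ^ 2 + b * x + c

/-- A (possibly degenerate) quadratic function of two real variables. -/
def IsQuadratic₂ (φ : ℝ → ℝ → ℝ) : Prop :=
  ∃ a b c d e k : ℝ, ∀ x y,
    φ x y = a * x ^ 2 + b * (x * y) + c * y ^ 2 + d * x + e * y + k

/-- The objective function `f(x) = (1/2) xᵀ Γ x - hᵀ x`. -/
noncomputable def objective {V : Type*} [Fintype V] (Γ : Matrix V V ℝ) (h : V → ℝ)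
    (x : V → ℝ) : ℝ :=
  (1 / 2) * (x ⬝ᵥ Γ.mulVec x) - h ⬝ᵥ x

/-- Component functions: one function `node i` of `x i` for every vertex, and one function of
`(x i, x j)` for every unordered pair, written `edge i j (x i) (x j)` when seen from `i`. Only the
values of `edge` on the edges of a graph are ever used. -/
structure Components (V : Type*) where
  node : V → ℝ → ℝ
  edge : V → V → ℝ → ℝ → ℝ
  edge_symm : ∀ i j a b, edge i j a b = edge j i b a

/-- The value at `x` of the component function of an unordered pair of vertices. -/
def Components.edgeTerm {V : Type*} (D : Components V) (x : V → ℝ) : Sym2 V → ℝ :=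
  Sym2.lift ⟨fun i j => D.edge i j (x i) (x j), fun i j => D.edge_symm i j (x i) (x j)⟩

section Graph

variable {V : Type*} [Fintype V] [DecidableEq V] (G : SimpleGraph V) [DecidableRel G.Adj]

/-- `D` is a decomposition of `f` into quadratic functions along the graph `G`: each component is
quadratic, and `f` is the sum of the vertex components and of one term per undirected edge. -/
structure IsQuadraticDecomposition (f : (V → ℝ) → ℝ) (D : Components V) : Prop where
  node_quadratic : ∀ i, IsQuadratic (D.node i)
  edge_quadratic : ∀ i j, G.Adj i j → IsQuadratic₂ (D.edge i j)
  sum_eq : ∀ x, f x = ∑ i, D.node i (x i) + ∑ e ∈ G.edgeFinset, D.edgeTerm x e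

/-- A convex decomposition: strictly convex vertex components and convex edge components. -/
structure IsConvexDecomposition (f : (V → ℝ) → ℝ) (D : Components V) : Prop
    extends IsQuadraticDecomposition G f D where
  node_strictConvex : ∀ i, StrictConvexOn ℝ Set.univ (D.node i)
  edge_convex : ∀ i j, G.Adj i j →
    ConvexOn ℝ Set.univ (fun p : ℝ × ℝ => D.edge i j p.1 p.2)

/-- The function of `yᵢ` that is minimized, for a given `xⱼ`, to compute the message from `i` to
`j`: `fᵢ(yᵢ) + fᵢⱼ(yᵢ, xⱼ) + ∑ u ∈ N(i) \ j, J_{u → i}(yᵢ)`. Here `J u i` is `J_{u → i}`. -/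
def messageObjective (D : Components V) (J : V → V → ℝ → ℝ) (i j : V) (xj yi : ℝ) : ℝ :=
  D.node i yi + D.edge i j yi xj + ∑ u ∈ (G.neighborFinset i).erase j, J u i yi

/-- The messages `J^(t)_{i → j}` of the min-sum algorithm with component functions `D` and
initial messages `J₀`; `κ t i j` is the offset used for the message from `i` to `j` at time `t`.
(The infimum is a minimum whenever the minimization is well posed.) -/
noncomputable def message (D : Components V) (J₀ : V → V → ℝ → ℝ) (κ : ℕ → V → V → ℝ) :
    ℕ → V → V → ℝ → ℝ
  | 0 => J₀
  | t + 1 => fun i j xj =>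
      κ t i j + ⨅ yi : ℝ, messageObjective G D (message D J₀ κ t) i j xj yi

/-- The local objective function of vertex `j` for messages `J`; an additive offset would not
change its minimizers. -/
def localObjective (D : Components V) (J : V → V → ℝ → ℝ) (j : V) (xj : ℝ) : ℝ :=
  D.node j xj + ∑ i ∈ G.neighborFinset j, J i j xj

end Graph

end MinSum

/-! Measure each message relative to the part of the edge component that depends on the receiving
vertex alone. The remaining curvatures `a` and slopes `b` then obey recursions that involve only `Γ`
and `h`: `a i j` becomes `-Γ i j ^ 2 / K` with `K = Γ i i + ∑ u ≠ j, a u i`, and the slopes follow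
an affine recursion with coefficients `-Γ i j / K`. The decomposition used by the algorithm enters
only through the initial values. Everything vanishes off the edges, so sums over neighbours can run
over all vertices.

The convex decomposition `g` distributes each `Γ i i` strictly into shares `p i j` with `Γ i j ^ 2 <
p i j * p j i` (`IsSplit`), and the convexity hypothesis says exactly enough to give `a ≥ -p j i` at
time zero. This bound is preserved (`lt_curvatureStep`) and keeps every `K` positive, so all
minimizations are well posed.

The curvature update is monotone and has a fixed point; the strict inequality at `-p` yields a
weighted norm in which the curvatures contract towards it (`tendsto_curvature`). The split also
makes `Γ` diagonally dominant after a positive rescaling (`exists_scaled_dominance`), which yields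
another weighted norm in which the limiting slope update contracts (`exists_slope_weight`). The
slopes therefore converge to the ones that encode `Γ⁻¹ h`, and the estimates converge to this
minimizer of the objective. -/

namespace MinSum

/-! ### Asymptotic contractions in weighted norms -/

/-- A perturbed scalar contraction forgets its initial value. -/
lemma tendsto_zero_of_affine_recurrence {θ : ℝ} (h0 : 0 ≤ θ) (h1 : θ < 1) {m ρ : ℕ → ℝ}
    (hm : ∀ n, m (n + 1) = θ * m n + ρ n) (hm0 : ∀ n, 0 ≤ m n)
    (hρ : Tendsto ρ atTop (𝓝 0)) : Tendsto m atTop (𝓝 0) := by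
  rw [Metric.tendsto_atTop]
  intro ε hε
  -- With this error level `ε / 2` is a fixed point of the scalar recursion, so the excess over `ε /
  -- 2` shrinks by the factor `θ`.
  have hδ : 0 < (ε / 2) * (1 - θ) := mul_pos (half_pos hε) (by linarith)
  obtain ⟨N, hN⟩ := eventually_atTop.1 (hρ.eventually (gt_mem_nhds hδ))
  have hb : ∀ n, m (N + n) - ε / 2 ≤ θ ^ n * m N := by
    intro n
    induction n with
    | zero => simp; linarith
    | succ n ih =>
      have h2 := hN (N + n) (by omega)
      have h3 := mul_le_mul_of_nonneg_left ih h0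
      rw [← add_assoc, hm, pow_succ]
      nlinarith
  have hpow : Tendsto (fun n => θ ^ n * m N) atTop (𝓝 0) := by
    simpa using (tendsto_pow_atTop_nhds_zero_of_lt_one h0 h1).mul_const (m N)
  obtain ⟨M, hM⟩ := eventually_atTop.1 (hpow.eventually (gt_mem_nhds (half_pos hε)))
  refine ⟨N + M, fun n hn => ?_⟩
  obtain ⟨k, rfl⟩ := Nat.exists_eq_add_of_le (show N ≤ n by omega)
  rw [Real.dist_eq, sub_zero, abs_of_nonneg (hm0 _)]
  have := hb k
  have := hM k (by omega)
  linarith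

section Core

variable {V : Type*} [Fintype V] [DecidableEq V]

/-- Nonnegative edge-indexed sequences dominated by an asymptotic contraction, up to a vanishing
error, tend to zero. The contraction is measured in the sup norm weighted by `v`. -/
lemma tendsto_zero_of_edge_contraction {e r c : ℕ → V → V → ℝ} {v c' : V → V → ℝ}
    (he : ∀ t i j, 0 ≤ e t i j) (hv : ∀ i j, 0 < v i j) (hc0 : ∀ t i j, 0 ≤ c t i j)
    (hc : ∀ i j, Tendsto (fun t => c t i j) atTop (𝓝 (c' i j)))
    (hv' : ∀ i j, c' i j * ∑ u ∈ Finset.univ.erase j, v u i < v i j)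
    (hr : ∀ i j, Tendsto (fun t => r t i j) atTop (𝓝 0))
    (hstep : ∀ t i j, e (t + 1) i j ≤ c t i j * ∑ u ∈ Finset.univ.erase j, e t u i + r t i j)
    (i j : V) : Tendsto (fun t => e t i j) atTop (𝓝 0) := by
  -- Finitely many strict inequalities survive a common factor slightly below 1.
  obtain ⟨θ, hθ, hθ0, hθ1⟩ : ∃ θ : ℝ,
      (∀ i j, c' i j * ∑ u ∈ Finset.univ.erase j, v u i < θ * v i j) ∧ 0 ≤ θ ∧ θ < 1 := by
    have h1 : ∀ᶠ θ : ℝ in 𝓝[<] 1,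
        ∀ i j, c' i j * ∑ u ∈ Finset.univ.erase j, v u i < θ * v i j := by
      simp only [eventually_all]
      intro i j
      have : Tendsto (fun θ : ℝ => θ * v i j) (𝓝[<] 1) (𝓝 (1 * v i j)) :=
        (tendsto_id.mul_const _).mono_left nhdsWithin_le_nhds
      exact this.eventually (lt_mem_nhds (by simpa using hv' i j))
    have h2 : ∀ᶠ θ : ℝ in 𝓝[<] 1, 0 ≤ θ :=
      Eventually.filter_mono nhdsWithin_le_nhds
        ((lt_mem_nhds (zero_lt_one (α := ℝ))).mono fun _ h => le_of_lt h)
    exact (h1.and (h2.and self_mem_nhdsWithin)).exists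
  have hev : ∀ᶠ t in atTop, ∀ i j,
      c t i j * ∑ u ∈ Finset.univ.erase j, v u i ≤ θ * v i j := by
    simp only [eventually_all]
    intro i j
    exact (((hc i j).mul_const _).eventually (gt_mem_nhds (hθ i j))).mono fun _ h => le_of_lt h
  obtain ⟨N, hN⟩ := eventually_atTop.1 hev
  -- A weighted `ℓ¹` norm serves as a convenient upper bound for the weighted sup norm.
  have le_norm : ∀ (f : V → V → ℝ) (i j), f i j ≤ (∑ i, ∑ j, |f i j| / v i j) * v i j := by
    intro f i j
    rw [← div_le_iff₀ (hv i j)]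
    have hnn : ∀ i j, 0 ≤ |f i j| / v i j := fun i j => div_nonneg (abs_nonneg _) (hv i j).le
    calc f i j / v i j ≤ |f i j| / v i j := by
          gcongr
          · exact (hv i j).le
          · exact le_abs_self _
      _ ≤ ∑ j, |f i j| / v i j :=
          Finset.single_le_sum (f := fun j => |f i j| / v i j) (fun j _ => hnn i j)
            (Finset.mem_univ j)
      _ ≤ _ := Finset.single_le_sum (f := fun i => ∑ j, |f i j| / v i j)
            (fun i _ => Finset.sum_nonneg fun j _ => hnn i j) (Finset.mem_univ i)
  have norm_nonneg : ∀ (f : V → V → ℝ), 0 ≤ ∑ i, ∑ j, |f i j| / v i j := fun f =>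
    Finset.sum_nonneg fun i _ => Finset.sum_nonneg fun j _ =>
      div_nonneg (abs_nonneg _) (hv i j).le
  let ρ : ℕ → ℝ := fun n => ∑ i, ∑ j, |r (N + n) i j| / v i j
  let m : ℕ → ℝ := fun n =>
    Nat.rec (∑ i, ∑ j, |e N i j| / v i j) (fun n x => θ * x + ρ n) n
  have hm : ∀ n, m (n + 1) = θ * m n + ρ n := fun n => rfl
  have hm0 : ∀ n, 0 ≤ m n := by
    intro n
    induction n with
    | zero => exact norm_nonneg _
    | succ n ih => rw [hm]; exact add_nonneg (mul_nonneg hθ0 ih) (norm_nonneg _)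
  have hρ : Tendsto ρ atTop (𝓝 0) := by
    have : Tendsto ρ atTop (𝓝 (∑ i : V, ∑ j : V, |(0 : ℝ)| / v i j)) := by
      refine tendsto_finsetSum _ fun i _ => tendsto_finsetSum _ fun j _ => ?_
      refine Tendsto.div_const (Tendsto.abs ?_) _
      exact (hr i j).comp (tendsto_add_atTop_nat N |>.congr fun n => by simp [add_comm])
    simpa using this
  have hbound : ∀ n i j, e (N + n) i j ≤ m n * v i j := by
    intro n
    induction n with
    | zero => exact le_norm (e N)
    | succ n ih =>
      intro i j
      have hs : ∑ u ∈ Finset.univ.erase j, e (N + n) u i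
          ≤ m n * ∑ u ∈ Finset.univ.erase j, v u i := by
        rw [Finset.mul_sum]
        exact Finset.sum_le_sum fun u _ => ih u i
      calc e (N + (n + 1)) i j
          ≤ c (N + n) i j * ∑ u ∈ Finset.univ.erase j, e (N + n) u i + r (N + n) i j :=
            hstep (N + n) i j
        _ ≤ c (N + n) i j * (m n * ∑ u ∈ Finset.univ.erase j, v u i) + ρ n * v i j :=
            add_le_add (mul_le_mul_of_nonneg_left hs (hc0 _ _ _)) (le_norm (r (N + n)) i j)
        _ = m n * (c (N + n) i j * ∑ u ∈ Finset.univ.erase j, v u i) + ρ n * v i j := by ring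
        _ ≤ m n * (θ * v i j) + ρ n * v i j := by
            exact add_le_add_left (mul_le_mul_of_nonneg_left
              (hN (N + n) (by omega) i j) (hm0 n)) _
        _ = m (n + 1) * v i j := by rw [hm]; ring
  have hlim : Tendsto (fun n => m n * v i j) atTop (𝓝 0) := by
    simpa using (tendsto_zero_of_affine_recurrence hθ0 hθ1 hm hm0 hρ).mul_const (v i j)
  have hshift : Tendsto (fun n => e (n + N) i j) atTop (𝓝 0) :=
    squeeze_zero (fun n => he _ _ _) (fun n => by rw [add_comm]; exact hbound n i j) hlim
  exact (tendsto_add_atTop_iff_nat N).1 hshift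

/-! ### Curvature and slope recursions for a split matrix -/

/-- The curvature of the minimization over `yᵢ` for the message from `i` to `j`, where `a` holds
the curvatures of the incoming messages. -/
def curvature (D : V → ℝ) (a : V → V → ℝ) (i j : V) : ℝ :=
  D i + ∑ u ∈ Finset.univ.erase j, a u i

/-- The update of the message curvatures. -/
noncomputable def curvatureStep (C : V → V → ℝ) (D : V → ℝ) (a : V → V → ℝ) (i j : V) : ℝ :=
  -(C i j ^ 2) / curvature D a i j

/-- The update of the message slopes. -/
noncomputable def slopeStep (C : V → V → ℝ) (D h : V → ℝ) (a b : V → V → ℝ) (i j : V) : ℝ :=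
  -(C i j / curvature D a i j) * (∑ u ∈ Finset.univ.erase j, b u i - h i)

/-- The off-diagonal entries `C` and the diagonal entries `D` are those of a matrix that is split
strictly, with the share `p i j` of the `i`-th diagonal entry going to the pair `{i, j}`. -/
structure IsSplit (C : V → V → ℝ) (D : V → ℝ) (p : V → V → ℝ) : Prop where
  symm : ∀ i j, C i j = C j i
  diag : ∀ i, C i i = 0
  pos : ∀ i j, 0 < p i j
  sq_lt : ∀ i j, C i j ^ 2 < p i j * p j i
  sum_lt : ∀ i, ∑ j, p i j < D i

lemma curvature_mono {D : V → ℝ} {a a' : V → V → ℝ} (h : ∀ i j, a i j ≤ a' i j) (i j : V) :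
    curvature D a i j ≤ curvature D a' i j :=
  add_le_add le_rfl (Finset.sum_le_sum fun u _ => h u i)

lemma curvature_sub (D : V → ℝ) (a a' : V → V → ℝ) (i j : V) :
    curvature D a i j - curvature D a' i j = ∑ u ∈ Finset.univ.erase j, (a u i - a' u i) := by
  rw [Finset.sum_sub_distrib, curvature, curvature]
  ring

variable {C : V → V → ℝ} {D : V → ℝ} {p : V → V → ℝ}

namespace IsSplit

/-- The incoming messages consume at most the shares of `D i` assigned to the vertices other than
`j`, which leaves more than the share `p i j`. -/
lemma lt_curvature (H : IsSplit C D p) {a : V → V → ℝ} (ha : ∀ i j, -p j i ≤ a i j) (i j : V) :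
    p i j < curvature D a i j := by
  have h1 := H.sum_lt i
  rw [← Finset.add_sum_erase _ _ (Finset.mem_univ j)] at h1
  have h2 : -∑ u ∈ Finset.univ.erase j, p i u ≤ ∑ u ∈ Finset.univ.erase j, a u i := by
    rw [← Finset.sum_neg_distrib]
    exact Finset.sum_le_sum fun u _ => ha u i
  unfold curvature
  linarith

lemma curvature_pos (H : IsSplit C D p) {a : V → V → ℝ} (ha : ∀ i j, -p j i ≤ a i j) (i j : V) :
    0 < curvature D a i j :=
  (H.pos i j).trans (H.lt_curvature ha i j)

/-- Invariance of the region `a ≥ -p`, with strict gain: `C ^ 2 < p j i * p i j < p j i * K`. -/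
lemma lt_curvatureStep (H : IsSplit C D p) {a : V → V → ℝ} (ha : ∀ i j, -p j i ≤ a i j)
    (i j : V) : -p j i < curvatureStep C D a i j := by
  have hK := H.curvature_pos ha i j
  unfold curvatureStep
  rw [lt_div_iff₀ hK]
  have := H.sq_lt i j
  have := mul_lt_mul_of_pos_left (H.lt_curvature ha i j) (H.pos j i)
  linarith

lemma curvatureStep_nonpos (H : IsSplit C D p) {a : V → V → ℝ} (ha : ∀ i j, -p j i ≤ a i j)
    (i j : V) : curvatureStep C D a i j ≤ 0 :=
  div_nonpos_of_nonpos_of_nonneg (neg_nonpos.2 (sq_nonneg _)) (H.curvature_pos ha i j).le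

lemma curvatureStep_mono (H : IsSplit C D p) {a a' : V → V → ℝ} (ha : ∀ i j, -p j i ≤ a i j)
    (h : ∀ i j, a i j ≤ a' i j) (i j : V) : curvatureStep C D a i j ≤ curvatureStep C D a' i j := by
  unfold curvatureStep
  rw [neg_div, neg_div, neg_le_neg_iff]
  exact div_le_div_of_nonneg_left (sq_nonneg _) (H.curvature_pos ha i j) (curvature_mono h i j)

/-- Being an identity, this serves twice in `tendsto_curvature`: for the error recursion, and to
produce the norm in which the error contracts. -/
lemma curvatureStep_sub (H : IsSplit C D p) {a a' : V → V → ℝ} (ha : ∀ i j, -p j i ≤ a i j)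
    (ha' : ∀ i j, -p j i ≤ a' i j) (i j : V) :
    curvatureStep C D a i j - curvatureStep C D a' i j =
      C i j ^ 2 / (curvature D a i j * curvature D a' i j) *
        ∑ u ∈ Finset.univ.erase j, (a u i - a' u i) := by
  have h1 := (H.curvature_pos ha i j).ne'
  have h2 := (H.curvature_pos ha' i j).ne'
  rw [← curvature_sub, curvatureStep, curvatureStep]
  field_simp
  ring

omit [DecidableEq V] in
lemma abs_mul_le (H : IsSplit C D p) (y : V → ℝ) (i j : V) :
    2 * (|C i j| * (y i * y j)) ≤ p i j * y i ^ 2 + p j i * y j ^ 2 := by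
  have h1 := H.pos i j
  have h2 : |C i j| ^ 2 ≤ p i j * p j i := by rw [sq_abs]; exact (H.sq_lt i j).le
  -- After multiplication by `p i j` the difference is a square plus a nonnegative multiple of `y j
  -- ^ 2`.
  refine le_of_mul_le_mul_left ?_ h1
  nlinarith [sq_nonneg (p i j * y i - |C i j| * y j), mul_le_mul_of_nonneg_right h2 (sq_nonneg (y j))]

omit [DecidableEq V] in
/-- The comparison matrix of a split matrix is positive definite. -/
lemma comparison_form_ge (H : IsSplit C D p) (y : V → ℝ) :
    ∑ i, (D i - ∑ j, p i j) * y i ^ 2 ≤ ∑ i, y i * (D i * y i - ∑ j, |C i j| * y j) := by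
  have h1 : ∑ i, ∑ j, 2 * (|C i j| * (y i * y j)) ≤
      ∑ i, ∑ j, (p i j * y i ^ 2 + p j i * y j ^ 2) :=
    Finset.sum_le_sum fun i _ => Finset.sum_le_sum fun j _ => H.abs_mul_le y i j
  have h2 : ∑ i, ∑ j, p j i * y j ^ 2 = ∑ i, ∑ j, p i j * y i ^ 2 := Finset.sum_comm
  simp only [Finset.sum_add_distrib, h2] at h1
  have h3 : ∑ i, (D i - ∑ j, p i j) * y i ^ 2
      = ∑ i, D i * y i ^ 2 - ∑ i, ∑ j, p i j * y i ^ 2 := by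
    simp only [sub_mul, Finset.sum_sub_distrib, Finset.sum_mul]
  have h4 : ∑ i, y i * (D i * y i - ∑ j, |C i j| * y j)
      = ∑ i, D i * y i ^ 2 - ∑ i, ∑ j, |C i j| * (y i * y j) := by
    rw [← Finset.sum_sub_distrib]
    refine Finset.sum_congr rfl fun i _ => ?_
    rw [mul_sub, Finset.mul_sum]
    congr 1
    · ring
    · exact Finset.sum_congr rfl fun j _ => by ring
  simp only [← Finset.mul_sum] at h1
  have h5 : ∑ i, ∑ j, |C i j| * (y i * y j) ≤ ∑ i, ∑ j, p i j * y i ^ 2 := by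
    simp only [← Finset.sum_mul] at h1 ⊢
    linarith
  rw [h3, h4]
  linarith

omit [DecidableEq V] in
lemma eq_zero_of_comparison_form_nonpos (H : IsSplit C D p) {y : V → ℝ}
    (hy : ∑ i, y i * (D i * y i - ∑ j, |C i j| * y j) ≤ 0) (i : V) : y i = 0 := by
  have hs : ∀ i, 0 < D i - ∑ j, p i j := fun i => sub_pos.2 (H.sum_lt i)
  have hnn : ∀ i ∈ Finset.univ, 0 ≤ (D i - ∑ j, p i j) * y i ^ 2 := fun i _ =>
    mul_nonneg (hs i).le (sq_nonneg _)
  have h0 := le_antisymm ((H.comparison_form_ge y).trans hy) (Finset.sum_nonneg hnn)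
  have := (Finset.sum_eq_zero_iff_of_nonneg hnn).1 h0 i (Finset.mem_univ i)
  rcases mul_eq_zero.1 this with h | h
  · exact absurd h (hs i).ne'
  · exact pow_eq_zero_iff two_ne_zero |>.1 h

omit [DecidableEq V] in
/-- A split matrix is strictly diagonally dominant after a positive rescaling. -/
lemma exists_scaled_dominance (H : IsSplit C D p) :
    ∃ x : V → ℝ, (∀ i, 0 < x i) ∧ ∀ i, ∑ j, |C i j| * x j < D i * x i := by
  let L : (V → ℝ) →ₗ[ℝ] (V → ℝ) :=
    { toFun := fun y i => D i * y i - ∑ j, |C i j| * y j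
      map_add' := fun y z => by
        funext i
        simp only [Pi.add_apply, mul_add, Finset.sum_add_distrib]
        ring
      map_smul' := fun c y => by
        funext i
        simp only [Pi.smul_apply, smul_eq_mul, RingHom.id_apply, mul_sub, Finset.mul_sum]
        congr 1
        · ring
        · exact Finset.sum_congr rfl fun j _ => by ring }
  have hinj : Function.Injective L := by
    rw [← LinearMap.ker_eq_bot, LinearMap.ker_eq_bot']
    intro y hy
    funext i
    refine H.eq_zero_of_comparison_form_nonpos (le_of_eq ?_) i
    refine Finset.sum_eq_zero fun i _ => ?_
    have : D i * y i - ∑ j, |C i j| * y j = 0 := congrFun hy i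
    rw [this, mul_zero]
  -- M-matrix argument: solve for the right-hand side 1. The negative part of the solution makes the
  -- comparison form nonpositive, hence vanishes.
  obtain ⟨x, hx⟩ := LinearMap.injective_iff_surjective.1 hinj (fun _ => 1)
  have hx' : ∀ i, D i * x i - ∑ j, |C i j| * x j = 1 := fun i => congrFun hx i
  have hneg : ∀ i, max (-x i) 0 = 0 := by
    refine H.eq_zero_of_comparison_form_nonpos (y := fun i => max (-x i) 0) ?_
    have hle : ∀ i, max (-x i) 0 * (D i * max (-x i) 0 - ∑ j, |C i j| * max (-x j) 0)
        ≤ -max (-x i) 0 := by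
      intro i
      have h0 : 0 ≤ max (-x i) 0 := le_max_right _ _
      have h1 : max (-x i) 0 * max (-x i) 0 = -(max (-x i) 0 * x i) := by
        rcases max_cases (-x i) 0 with ⟨h, -⟩ | ⟨h, -⟩ <;> rw [h] <;> ring
      have h2 : -∑ j, |C i j| * max (-x j) 0 ≤ ∑ j, |C i j| * x j := by
        rw [← Finset.sum_neg_distrib]
        refine Finset.sum_le_sum fun j _ => ?_
        have := mul_le_mul_of_nonneg_left (le_max_left (-x j) 0) (abs_nonneg (C i j))
        linarith
      have h3 := mul_le_mul_of_nonneg_left h2 h0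
      have h4 : max (-x i) 0 * (D i * x i - ∑ j, |C i j| * x j) = max (-x i) 0 * 1 := by
        rw [hx' i]
      have h5 : D i * (max (-x i) 0 * max (-x i) 0) = D i * -(max (-x i) 0 * x i) := by rw [h1]
      linarith
    calc _ ≤ ∑ i, -max (-x i) 0 := Finset.sum_le_sum fun i _ => hle i
      _ ≤ 0 := Finset.sum_nonpos fun i _ => neg_nonpos.2 (le_max_right _ _)
  have hx0 : ∀ i, 0 ≤ x i := fun i => by
    have := le_max_left (-x i) 0
    rw [hneg i] at this
    linarith
  have hlt : ∀ i, ∑ j, |C i j| * x j < D i * x i := fun i => by linarith [hx' i]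
  refine ⟨x, fun i => lt_of_le_of_ne (hx0 i) fun h => ?_, hlt⟩
  have h1 := hlt i
  rw [← h, mul_zero] at h1
  exact absurd h1 (not_lt.2 (Finset.sum_nonneg fun j _ => mul_nonneg (abs_nonneg _) (hx0 j)))

/-- The bookkeeping of `lt_curvature`, with the shares `|C i u| * x u / x i` in place of `p i u`. -/
lemma mul_lt_curvature_mul (H : IsSplit C D p) {x : V → ℝ} (hx : ∀ i, 0 < x i)
    (hd : ∀ i, ∑ j, |C i j| * x j < D i * x i) {a : V → V → ℝ}
    (ha : ∀ i j, -(|C i j| * x i) / x j ≤ a i j) (i j : V) :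
    |C i j| * x j < curvature D a i j * x i := by
  have h1 := hd i
  rw [← Finset.add_sum_erase _ _ (Finset.mem_univ j)] at h1
  have h2 : -∑ u ∈ Finset.univ.erase j, |C i u| * x u
      ≤ (∑ u ∈ Finset.univ.erase j, a u i) * x i := by
    rw [← Finset.sum_neg_distrib, Finset.sum_mul]
    refine Finset.sum_le_sum fun u _ => ?_
    have := ha u i
    rw [div_le_iff₀ (hx i), H.symm u i] at this
    exact this
  unfold curvature
  linarith

/-- The message curvatures have a fixed point, which inherits any scaled diagonal dominance. -/
lemma exists_fixed_curvature (H : IsSplit C D p) {x : V → ℝ} (hx : ∀ i, 0 < x i)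
    (hd : ∀ i, ∑ j, |C i j| * x j < D i * x i) :
    ∃ a : V → V → ℝ, (∀ i j, -p j i < a i j) ∧ (∀ i j, -(|C i j| * x i) / x j ≤ a i j) ∧
      ∀ i j, curvatureStep C D a i j = a i j := by
  -- Both lower bounds are preserved by the update: the first controls the curvature limit, the
  -- second will make the slope weights positive.
  let l : V → V → ℝ := fun i j => max (-p j i) (-(|C i j| * x i) / x j)
  have hl : l ≤ 0 := fun i j => max_le (neg_nonpos.2 (H.pos j i).le)
    (div_nonpos_of_nonpos_of_nonneg
      (neg_nonpos.2 (mul_nonneg (abs_nonneg _) (hx i).le)) (hx j).le)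
  have hp : ∀ a : V → V → ℝ, l ≤ a → ∀ i j, -p j i ≤ a i j := fun a ha i j =>
    (le_max_left _ _).trans (ha i j)
  have hq : ∀ a : V → V → ℝ, l ≤ a → ∀ i j, -(|C i j| * x i) / x j ≤ a i j := fun a ha i j =>
    (le_max_right _ _).trans (ha i j)
  have hmaps : ∀ a : V → V → ℝ, l ≤ a → curvatureStep C D a ∈ Set.Icc l 0 := by
    refine fun a ha => ⟨fun i j => max_le (H.lt_curvatureStep (hp a ha) i j).le ?_,
      fun i j => H.curvatureStep_nonpos (hp a ha) i j⟩
    have hK := H.curvature_pos (hp a ha) i j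
    have h1 := H.mul_lt_curvature_mul hx hd (hq a ha) i j
    unfold curvatureStep
    rw [div_le_div_iff₀ (hx j) hK, ← sq_abs]
    nlinarith [mul_le_mul_of_nonneg_left h1.le (abs_nonneg (C i j))]
  -- The interval is a complete lattice and the update is monotone on it, so Knaster–Tarski gives a
  -- fixed point.
  have : Fact (l ≤ 0) := ⟨hl⟩
  let T : Set.Icc l 0 →o Set.Icc l 0 :=
    { toFun := fun a => ⟨curvatureStep C D a.1, hmaps a.1 a.2.1⟩
      monotone' := fun a a' h i j => H.curvatureStep_mono (hp a.1 a.2.1) h i j }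
  have hfix := congrArg Subtype.val T.map_lfp
  refine ⟨(OrderHom.lfp T).1, fun i j => ?_, hq _ (OrderHom.lfp T).2.1,
    fun i j => congrFun (congrFun hfix i) j⟩
  have h1 := H.lt_curvatureStep (hp _ (OrderHom.lfp T).2.1) i j
  rwa [show curvatureStep C D (OrderHom.lfp T).1 i j = (OrderHom.lfp T).1 i j from
    congrFun (congrFun hfix i) j] at h1

/-- The message curvatures converge to their fixed point. -/
lemma tendsto_curvature (H : IsSplit C D p) {a : ℕ → V → V → ℝ} (ha0 : ∀ i j, -p j i ≤ a 0 i j)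
    (ha : ∀ t i j, a (t + 1) i j = curvatureStep C D (a t) i j) {a' : V → V → ℝ}
    (ha' : ∀ i j, -p j i < a' i j) (hfix : ∀ i j, curvatureStep C D a' i j = a' i j) (i j : V) :
    Tendsto (fun t => a t i j) atTop (𝓝 (a' i j)) := by
  have hlb : ∀ t i j, -p j i ≤ a t i j := by
    intro t
    induction t with
    | zero => exact ha0
    | succ t ih => exact fun i j => by rw [ha]; exact (H.lt_curvatureStep ih i j).le
  -- The weight is `a' - w`. The update fixes `a'` and strictly raises `w`, so it shrinks their
  -- difference. The coefficients `c` of this comparison dominate those along the actual sequence,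
  -- since the curvatures at `a t` are at least those at `w`.
  let w : V → V → ℝ := fun i j => -p j i
  have hw : ∀ i j, -p j i ≤ w i j := fun i j => le_rfl
  have ha'' : ∀ i j, -p j i ≤ a' i j := fun i j => (ha' i j).le
  have hKw := H.curvature_pos hw
  have hK' := H.curvature_pos ha''
  let c : V → V → ℝ := fun i j => C i j ^ 2 / (curvature D w i j * curvature D a' i j)
  have hc : ∀ i j, 0 ≤ c i j := fun i j =>
    div_nonneg (sq_nonneg _) (mul_pos (hKw i j) (hK' i j)).le
  have key := tendsto_zero_of_edge_contraction (e := fun t i j => |a t i j - a' i j|)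
    (r := fun _ _ _ => 0) (c := fun _ => c) (c' := c) (v := fun i j => a' i j - w i j)
    (fun _ _ _ => abs_nonneg _) (fun i j => sub_pos.2 (ha' i j)) (fun _ => hc)
    (fun _ _ => tendsto_const_nhds) ?_ (fun _ _ => tendsto_const_nhds) ?_ i j
  · rw [tendsto_iff_dist_tendsto_zero]
    exact key
  · intro i j
    have h1 := H.curvatureStep_sub ha'' hw i j
    have h2 := H.lt_curvatureStep hw i j
    rw [hfix, mul_comm (curvature D a' i j)] at h1
    simp only [c]
    rw [← h1]
    exact sub_lt_sub_left h2 _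
  · intro t i j
    have hKt := H.curvature_pos (hlb t) i j
    rw [add_zero, ha, ← hfix i j, H.curvatureStep_sub (hlb t) ha'', abs_mul,
      abs_of_nonneg (div_nonneg (sq_nonneg _) (mul_pos hKt (hK' i j)).le)]
    refine mul_le_mul ?_ (Finset.abs_sum_le_sum_abs _ _) (abs_nonneg _) (hc i j)
    refine div_le_div_of_nonneg_left (sq_nonneg _) (mul_pos (hKw i j) (hK' i j)) ?_
    exact mul_le_mul_of_nonneg_right (curvature_mono (hlb t) i j) (hK' i j).le

/-- At the fixed point of the curvatures, the slope update is a contraction in a weighted sup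
norm. -/
lemma exists_slope_weight (H : IsSplit C D p) {x : V → ℝ} (hx : ∀ i, 0 < x i)
    (hd : ∀ i, ∑ j, |C i j| * x j < D i * x i) {a : V → V → ℝ}
    (hap : ∀ i j, -p j i < a i j) (haq : ∀ i j, -(|C i j| * x i) / x j ≤ a i j)
    (hfix : ∀ i j, curvatureStep C D a i j = a i j) :
    ∃ v : V → V → ℝ, (∀ i j, 0 < v i j) ∧
      ∀ i j, |C i j| / curvature D a i j * ∑ u ∈ Finset.univ.erase j, v u i < v i j := by
  have hK := H.curvature_pos fun i j => (hap i j).le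
  obtain ⟨ε, hε, hε0⟩ : ∃ ε : ℝ,
      (∀ i, Fintype.card V * ε < D i * x i - ∑ j, |C i j| * x j) ∧ 0 < ε := by
    have h1 : ∀ᶠ ε : ℝ in 𝓝[>] 0,
        ∀ i, Fintype.card V * ε < D i * x i - ∑ j, |C i j| * x j := by
      rw [eventually_all]
      intro i
      have : Tendsto (fun ε : ℝ => Fintype.card V * ε) (𝓝[>] 0) (𝓝 (Fintype.card V * 0)) :=
        (tendsto_id.const_mul _).mono_left nhdsWithin_le_nhds
      exact this.eventually (gt_mem_nhds (by simpa using hd i))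
    exact (h1.and self_mem_nhdsWithin).exists
  have hnn : ∀ i j, 0 ≤ |C i j| * x i + a i j * x j := by
    intro i j
    have := haq i j
    rw [div_le_iff₀ (hx j)] at this
    linarith
  -- Without `ε` this weight is only nonnegative: it vanishes where `C i j = 0`. The slack in the
  -- scaled dominance absorbs the added `ε`.
  refine ⟨fun i j => |C i j| * x i + a i j * x j + ε, fun i j => by linarith [hnn i j],
    fun i j => ?_⟩
  have hcard : ∑ u ∈ Finset.univ.erase j, ε ≤ Fintype.card V * ε := by
    rw [Finset.sum_const, nsmul_eq_mul]
    have : (Finset.univ.erase j).card ≤ Fintype.card V := Finset.card_le_univ _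
    gcongr
  have hsum : ∑ u ∈ Finset.univ.erase j, (|C u i| * x u + a u i * x i + ε) ≤
      curvature D a i j * x i - |C i j| * x j := by
    have h1 := hε i
    rw [← Finset.add_sum_erase _ _ (Finset.mem_univ j)] at h1
    rw [Finset.sum_add_distrib, Finset.sum_add_distrib, ← Finset.sum_mul]
    simp only [H.symm _ i]
    unfold curvature
    linarith
  calc |C i j| / curvature D a i j * ∑ u ∈ Finset.univ.erase j,
        (|C u i| * x u + a u i * x i + ε)
      ≤ |C i j| / curvature D a i j * (curvature D a i j * x i - |C i j| * x j) :=
        mul_le_mul_of_nonneg_left hsum (div_nonneg (abs_nonneg _) (hK i j).le)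
    _ = |C i j| * x i + a i j * x j := by
        rw [← hfix i j, curvatureStep, ← sq_abs]
        have := (hK i j).ne'
        field_simp
        ring
    _ < _ := by linarith

/-- The message slopes converge to the ones that encode the solution of the linear system. -/
lemma tendsto_slope (H : IsSplit C D p) {h x₀ : V → ℝ}
    (hx₀ : ∀ i, D i * x₀ i + ∑ j, C i j * x₀ j = h i) {a b : ℕ → V → V → ℝ}
    (ha0 : ∀ i j, -p j i ≤ a 0 i j) (ha : ∀ t i j, a (t + 1) i j = curvatureStep C D (a t) i j)
    (hb : ∀ t i j, b (t + 1) i j = slopeStep C D h (a t) (b t) i j) :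
    ∃ a' : V → V → ℝ, (∀ i j, -p j i < a' i j) ∧
      (∀ i j, Tendsto (fun t => a t i j) atTop (𝓝 (a' i j))) ∧
      ∀ i j, Tendsto (fun t => b t i j) atTop (𝓝 (C i j * x₀ i - a' i j * x₀ j)) := by
  obtain ⟨x, hx, hd⟩ := H.exists_scaled_dominance
  obtain ⟨a', hap, haq, hfix⟩ := H.exists_fixed_curvature hx hd
  obtain ⟨v, hv, hv'⟩ := H.exists_slope_weight hx hd hap haq hfix
  have hlim := H.tendsto_curvature ha0 ha hap hfix
  refine ⟨a', hap, hlim, fun i j => ?_⟩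
  have hlb : ∀ t i j, -p j i ≤ a t i j := by
    intro t
    induction t with
    | zero => exact ha0
    | succ t ih => exact fun i j => by rw [ha]; exact (H.lt_curvatureStep ih i j).le
  have hK' := H.curvature_pos fun i j => (hap i j).le
  have hKt := fun t => H.curvature_pos (hlb t)
  have hKlim : ∀ i j, Tendsto (fun t => curvature D (a t) i j) atTop (𝓝 (curvature D a' i j)) :=
    fun i j => tendsto_const_nhds.add (tendsto_finsetSum _ fun u _ => hlim u i)
  -- These slopes make the limiting message minimizations compatible with `x₀`, so they are fixed by
  -- the limiting update.
  let b' : V → V → ℝ := fun i j => C i j * x₀ i - a' i j * x₀ j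
  have hbfix : ∀ i j, slopeStep C D h a' b' i j = b' i j := by
    intro i j
    have hsum : ∑ u ∈ Finset.univ.erase j, b' u i - h i
        = -(C i j * x₀ j) - curvature D a' i j * x₀ i := by
      have h1 := hx₀ i
      rw [← Finset.add_sum_erase _ _ (Finset.mem_univ j)] at h1
      simp only [b', Finset.sum_sub_distrib, ← Finset.sum_mul, H.symm _ i]
      unfold curvature
      linarith
    have hK := (hK' i j).ne'
    rw [slopeStep, hsum]
    simp only [b']
    rw [← hfix i j, curvatureStep]
    field_simp
    ring
  -- The coefficients still vary with `t`; replacing them by their limits at the fixed slopes `b'`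
  -- costs the vanishing error `r`.
  have key := tendsto_zero_of_edge_contraction (e := fun t i j => |b t i j - b' i j|)
    (c := fun t i j => |C i j| / curvature D (a t) i j)
    (c' := fun i j => |C i j| / curvature D a' i j) (v := v)
    (r := fun t i j => |slopeStep C D h (a t) b' i j - slopeStep C D h a' b' i j|)
    (fun _ _ _ => abs_nonneg _) hv (fun t i j => div_nonneg (abs_nonneg _) (hKt t i j).le)
    (fun i j => tendsto_const_nhds.div (hKlim i j) (hK' i j).ne') hv' ?_ ?_ i j
  · rw [tendsto_iff_dist_tendsto_zero]
    exact key
  · intro i j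
    have h1 : Tendsto (fun t => slopeStep C D h (a t) b' i j) atTop
        (𝓝 (slopeStep C D h a' b' i j)) :=
      ((tendsto_const_nhds.div (hKlim i j) (hK' i j).ne').neg).mul_const _
    simpa using (h1.sub_const (slopeStep C D h a' b' i j)).abs
  · intro t i j
    have h1 : b (t + 1) i j - b' i j
        = -(C i j / curvature D (a t) i j) * ∑ u ∈ Finset.univ.erase j, (b t u i - b' u i)
          + (slopeStep C D h (a t) b' i j - slopeStep C D h a' b' i j) := by
      rw [hbfix, hb, Finset.sum_sub_distrib, slopeStep, slopeStep]
      ring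
    rw [h1]
    refine (abs_add_le _ _).trans (add_le_add ?_ le_rfl)
    rw [abs_mul, abs_neg, abs_div, abs_of_pos (hKt t i j)]
    exact mul_le_mul_of_nonneg_left (Finset.abs_sum_le_sum_abs _ _)
      (div_nonneg (abs_nonneg _) (hKt t i j).le)

end IsSplit

end Core

end MinSum

/-! ### Quadratic functions of one and two variables -/

namespace MinSum

lemma isMinOn_quadratic_iff {φ : ℝ → ℝ} {A B c : ℝ} (hA : 0 < A)
    (hφ : ∀ y, φ y = A / 2 * y ^ 2 + B * y + c) (y : ℝ) :
    IsMinOn φ Set.univ y ↔ y = -B / A := by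
  have hsq : ∀ z, φ z = A / 2 * (z - -B / A) ^ 2 + φ (-B / A) := fun z => by
    rw [hφ, hφ]
    field_simp
    ring
  rw [isMinOn_iff]
  constructor
  · intro h
    have h1 := h (-B / A) (Set.mem_univ _)
    rw [hsq y] at h1
    have h2 : (y - -B / A) ^ 2 ≤ 0 := by nlinarith
    exact sub_eq_zero.1 (pow_eq_zero_iff two_ne_zero |>.1 (le_antisymm h2 (sq_nonneg _)))
  · rintro rfl z -
    rw [hsq z]
    nlinarith [sq_nonneg (z - -B / A)]

lemma iInf_quadratic {φ : ℝ → ℝ} {A B c : ℝ} (hA : 0 < A)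
    (hφ : ∀ y, φ y = A / 2 * y ^ 2 + B * y + c) : ⨅ y, φ y = c - B ^ 2 / (2 * A) := by
  have hmin := isMinOn_iff.1 ((isMinOn_quadratic_iff hA hφ (-B / A)).2 rfl)
  have hval : φ (-B / A) = c - B ^ 2 / (2 * A) := by
    rw [hφ]
    field_simp
    ring
  rw [← hval]
  exact le_antisymm (ciInf_le ⟨_, Set.forall_mem_range.2 fun y => hmin y (Set.mem_univ _)⟩ _)
    (le_ciInf fun y => hmin y (Set.mem_univ _))

/-- The second-order coefficient of a quadratic function, that is, its second derivative. -/
def quadCoeff (φ : ℝ → ℝ) : ℝ := φ 1 + φ (-1) - 2 * φ 0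

/-- The first-order coefficient of a quadratic function. -/
noncomputable def linCoeff (φ : ℝ → ℝ) : ℝ := (φ 1 - φ (-1)) / 2

lemma IsQuadratic.eq_coeff {φ : ℝ → ℝ} (hφ : IsQuadratic φ) (x : ℝ) :
    φ x = quadCoeff φ / 2 * x ^ 2 + linCoeff φ * x + φ 0 := by
  obtain ⟨a, b, c, h⟩ := hφ
  simp only [quadCoeff, linCoeff, h]
  ring

/-- The coefficient of the product in a quadratic function of two variables. -/
def crossCoeff (φ : ℝ → ℝ → ℝ) : ℝ := φ 1 1 - φ 1 0 - φ 0 1 + φ 0 0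

lemma IsQuadratic₂.eq_coeff {φ : ℝ → ℝ → ℝ} (hφ : IsQuadratic₂ φ) (x y : ℝ) :
    φ x y = quadCoeff (φ · 0) / 2 * x ^ 2 + crossCoeff φ * (x * y) + quadCoeff (φ 0) / 2 * y ^ 2
      + linCoeff (φ · 0) * x + linCoeff (φ 0) * y + φ 0 0 := by
  obtain ⟨a, b, c, d, e, k, h⟩ := hφ
  simp only [quadCoeff, linCoeff, crossCoeff, h]
  ring

lemma quadCoeff_pos_of_strictConvexOn {φ : ℝ → ℝ} (h : StrictConvexOn ℝ Set.univ φ) :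
    0 < quadCoeff φ := by
  have := h.2 (Set.mem_univ 1) (Set.mem_univ (-1)) (by norm_num) (half_pos one_pos)
    (half_pos one_pos) (add_halves 1)
  simp only [smul_eq_mul] at this
  norm_num at this
  unfold quadCoeff
  linarith

/-- A convex function of two variables lies above its value at the centre, in symmetric mean. -/
lemma two_mul_zero_le_of_convexOn {φ : ℝ → ℝ → ℝ}
    (h : ConvexOn ℝ Set.univ fun p : ℝ × ℝ => φ p.1 p.2) (x y : ℝ) :
    2 * φ 0 0 ≤ φ x y + φ (-x) (-y) := by
  have := h.2 (Set.mem_univ (x, y)) (Set.mem_univ (-x, -y)) (half_pos one_pos).le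
    (half_pos one_pos).le (add_halves (1 : ℝ))
  simp only [smul_eq_mul, Prod.smul_mk, Prod.mk_add_mk] at this
  rw [show 1 / 2 * x + 1 / 2 * -x = 0 by ring, show 1 / 2 * y + 1 / 2 * -y = 0 by ring] at this
  linarith

/-! ### Coefficients of decompositions -/

section Graph

variable {V : Type*} [Fintype V] [DecidableEq V] (G : SimpleGraph V) [DecidableRel G.Adj]

/-- The nonzero terms are indexed by darts, and every edge carries two of them. -/
lemma sum_sum_adj_eq_two_mul_sum_edgeFinset (φ : Sym2 V → ℝ) :
    ∑ i, ∑ j, (if G.Adj i j then φ s(i, j) else 0) = 2 * ∑ e ∈ G.edgeFinset, φ e := by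
  have h1 : ∑ d : G.Dart, φ d.edge = 2 * ∑ e ∈ G.edgeFinset, φ e := by
    rw [← Finset.sum_fiberwise_of_maps_to (g := fun d : G.Dart => d.edge) (t := G.edgeFinset)
      (fun d _ => SimpleGraph.mem_edgeFinset.2 d.edge_mem), Finset.mul_sum]
    refine Finset.sum_congr rfl fun e he => ?_
    rw [Finset.sum_congr rfl fun d hd => congrArg φ (Finset.mem_filter.1 hd).2, Finset.sum_const,
      G.dart_edge_fiber_card e (SimpleGraph.mem_edgeFinset.1 he), nsmul_eq_mul, Nat.cast_ofNat]
  rw [← h1, ← Fintype.sum_prod_type' (f := fun i j => if G.Adj i j then φ s(i, j) else 0),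
    ← Finset.sum_filter]
  refine (Finset.sum_bij (fun (d : G.Dart) _ => d.toProd) ?_ ?_ ?_ ?_).symm
  · exact fun d _ => by simp
  · exact fun d _ d' _ h => SimpleGraph.Dart.ext _ _ h
  · exact fun q hq => ⟨⟨q, by simpa using hq⟩, Finset.mem_univ _, rfl⟩
  · exact fun d _ => rfl

/-- The coefficients of a quadratic function on `ℝ^V` are determined by its values. -/
lemma objective_coeff_unique {A B : Matrix V V ℝ} {h k : V → ℝ} {c : ℝ}
    (hA : A.IsSymm) (hB : B.IsSymm) (H : ∀ x, objective A h x = objective B k x + c) :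
    A = B ∧ h = k := by
  have hc : c = 0 := by simpa [objective, eq_comm] using H 0
  subst hc
  have hneg : ∀ (A : Matrix V V ℝ) (h x : V → ℝ),
      objective A h (-x) = (1 / 2) * (x ⬝ᵥ A.mulVec x) + h ⬝ᵥ x := fun A h x => by
    simp [objective, Matrix.mulVec_neg]
  -- Comparing `x` with `-x` separates the odd part from the even one; polarization on basis vectors
  -- then recovers the matrix entries.
  have hlin : ∀ x, h ⬝ᵥ x = k ⬝ᵥ x := fun x => by
    have h1 := H x
    have h2 := H (-x)
    rw [hneg, hneg] at h2
    unfold objective at h1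
    linarith
  have hquad : ∀ x, x ⬝ᵥ A.mulVec x = x ⬝ᵥ B.mulVec x := fun x => by
    have h1 := H x
    unfold objective at h1
    linarith [hlin x]
  refine ⟨?_, funext fun i => by simpa using hlin (Pi.single i 1)⟩
  ext i j
  have h1 := hquad (Pi.single i 1)
  have h2 := hquad (Pi.single j 1)
  have h3 := hquad (Pi.single i 1 + Pi.single j 1)
  simp only [Matrix.mulVec_add, add_dotProduct, dotProduct_add, single_dotProduct, one_mul,
    Matrix.mulVec_single_one, Matrix.col_apply] at h1 h2 h3
  have := hA.apply i j
  have := hB.apply i j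
  linarith

/-- The coefficients of the components of a quadratic decomposition of `objective Γ h`. The part of
the component of `{i, j}` that depends on `x i` alone has coefficients `P i j` and `d i j`. -/
structure HasCoeffs (Γ : Matrix V V ℝ) (h : V → ℝ) (D : Components V) (S m : V → ℝ)
    (P d : V → V → ℝ) : Prop where
  quad_eq_zero : ∀ i j, ¬G.Adj i j → P i j = 0
  lin_eq_zero : ∀ i j, ¬G.Adj i j → d i j = 0
  matrix_eq_zero : ∀ i j, i ≠ j → ¬G.Adj i j → Γ i j = 0
  node_eq : ∀ i x, D.node i x = S i / 2 * x ^ 2 + m i * x + D.node i 0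
  edge_eq : ∀ i j, G.Adj i j → ∀ x y, D.edge i j x y =
    P i j / 2 * x ^ 2 + Γ i j * (x * y) + P j i / 2 * y ^ 2 + d i j * x + d j i * y + D.edge i j 0 0
  diag_eq : ∀ i, Γ i i = S i + ∑ j, P i j
  field_eq : ∀ i, -h i = m i + ∑ j, d i j

variable {G} {Γ : Matrix V V ℝ} {h : V → ℝ}

lemma IsQuadraticDecomposition.exists_hasCoeffs {D : Components V} (hΓ : Γ.IsSymm)
    (hD : IsQuadraticDecomposition G (objective Γ h) D) :
    ∃ m P d, HasCoeffs G Γ h D (fun i => quadCoeff (D.node i)) m P d := by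
  let S : V → ℝ := fun i => quadCoeff (D.node i)
  let m : V → ℝ := fun i => linCoeff (D.node i)
  let P : V → V → ℝ := fun i j => if G.Adj i j then quadCoeff (D.edge i j · 0) else 0
  let d : V → V → ℝ := fun i j => if G.Adj i j then linCoeff (D.edge i j · 0) else 0
  let X : V → V → ℝ := fun i j => if G.Adj i j then crossCoeff (D.edge i j) else 0
  have hX : ∀ i j, X i j = X j i := fun i j => by
    simp only [X, G.adj_comm i j, crossCoeff, D.edge_symm j i]
    split_ifs <;> ring
  have hXd : ∀ i, X i i = 0 := fun i => by simp [X]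
  have hedge : ∀ i j, G.Adj i j → ∀ x y, D.edge i j x y =
      P i j / 2 * x ^ 2 + X i j * (x * y) + P j i / 2 * y ^ 2 + d i j * x + d j i * y
        + D.edge i j 0 0 := by
    intro i j hij x y
    rw [(hD.edge_quadratic i j hij).eq_coeff x y]
    simp only [P, d, X, hij, hij.symm, if_true, D.edge_symm j i]
  have hnode : ∀ i x, D.node i x = S i / 2 * x ^ 2 + m i * x + D.node i 0 := fun i x =>
    (hD.node_quadratic i).eq_coeff x
  -- The matrix assembled from the components; uniqueness of coefficients identifies it with `Γ`,
  -- which is therefore zero off the edges and the diagonal.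
  let B : Matrix V V ℝ := Matrix.of X + Matrix.diagonal fun i => S i + ∑ j, P i j
  have hB : B.IsSymm := by
    refine Matrix.IsSymm.add ?_ (Matrix.isSymm_diagonal _)
    ext i j
    exact hX j i
  have hobj : ∀ x, objective Γ h x = objective B (fun i => -(m i + ∑ j, d i j)) x
      + (∑ i, D.node i 0 + ∑ i, ∑ j, if G.Adj i j then D.edge i j 0 0 / 2 else 0) := by
    intro x
    have h1 := sum_sum_adj_eq_two_mul_sum_edgeFinset G (D.edgeTerm x)
    have h2 : ∑ i, ∑ j, (if G.Adj i j then D.edgeTerm x s(i, j) else 0)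
        = ∑ i, ∑ j, (P i j / 2 * x i ^ 2 + d i j * x i) + ∑ i, ∑ j, X i j * (x i * x j)
          + ∑ i, ∑ j, (P j i / 2 * x j ^ 2 + d j i * x j)
          + 2 * ∑ i, ∑ j, (if G.Adj i j then D.edge i j 0 0 / 2 else 0) := by
      simp only [Finset.mul_sum, ← Finset.sum_add_distrib]
      refine Finset.sum_congr rfl fun i _ => Finset.sum_congr rfl fun j _ => ?_
      by_cases hij : G.Adj i j
      · simp only [hij, if_true]
        change D.edge i j (x i) (x j) = _
        rw [hedge i j hij]
        ring
      · have hji : ¬G.Adj j i := fun h => hij h.symm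
        simp [P, d, X, hij, hji]
    rw [Finset.sum_comm (f := fun i j => P j i / 2 * x j ^ 2 + d j i * x j)] at h2
    have h3 : ∑ i, D.node i (x i)
        = ∑ i, (S i / 2 * x i ^ 2 + m i * x i) + ∑ i, D.node i 0 := by
      rw [← Finset.sum_add_distrib]
      exact Finset.sum_congr rfl fun i _ => hnode i (x i)
    have h4 : objective B (fun i => -(m i + ∑ j, d i j)) x
        = ∑ i, (S i / 2 * x i ^ 2 + m i * x i) + ∑ i, ∑ j, (P i j / 2 * x i ^ 2 + d i j * x i)
          + (∑ i, ∑ j, X i j * (x i * x j)) / 2 := by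
      have hBx : ∀ i, B.mulVec x i = ∑ j, X i j * x j + (S i + ∑ j, P i j) * x i := fun i => by
        simp only [B, Matrix.add_mulVec, Pi.add_apply, Matrix.mulVec_diagonal]
        rfl
      simp only [objective, dotProduct, hBx, Finset.sum_div, Finset.mul_sum,
        ← Finset.sum_add_distrib, ← Finset.sum_sub_distrib]
      refine Finset.sum_congr rfl fun i _ => ?_
      simp only [Finset.sum_add_distrib, ← Finset.sum_mul, ← Finset.sum_div]
      have h5 : ∑ j, X i j * (x i * x j) = x i * ∑ j, X i j * x j := by
        rw [Finset.mul_sum]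
        exact Finset.sum_congr rfl fun j _ => by ring
      rw [h5]
      ring
    rw [hD.sum_eq, h4, h3]
    linarith
  obtain ⟨hΓB, hh⟩ := objective_coeff_unique hΓ hB hobj
  have hoff : ∀ i j, i ≠ j → Γ i j = X i j := fun i j hij => by
    simp [hΓB, B, Matrix.diagonal_apply_ne _ hij]
  refine ⟨m, P, d, fun i j hij => by simp [P, hij], fun i j hij => by simp [d, hij],
    fun i j hne hij => by rw [hoff i j hne]; simp [X, hij], hnode,
    fun i j hij x y => by rw [hoff i j hij.ne]; exact hedge i j hij x y,
    fun i => by simp [hΓB, B, hXd, S], fun i => by rw [hh]; simp⟩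

/-- The off-diagonal part of a matrix, as a function. -/
def offDiag (Γ : Matrix V V ℝ) (i j : V) : ℝ := if i = j then 0 else Γ i j

/-- A convex decomposition splits the matrix of the objective. -/
lemma IsConvexDecomposition.exists_isSplit {g : Components V} (hΓ : Γ.IsSymm)
    (hg : IsConvexDecomposition G (objective Γ h) g) {m : V → ℝ} {P d : V → V → ℝ}
    (hc : HasCoeffs G Γ h g (fun i => quadCoeff (g.node i)) m P d) :
    ∃ p, IsSplit (offDiag Γ) (fun i => Γ i i) p ∧ ∀ i j, P i j ≤ p i j := by
  have hform : ∀ i j, G.Adj i j → ∀ x y : ℝ,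
      0 ≤ P i j * (x * x) + 2 * Γ i j * x * y + P j i * (y * y) := by
    intro i j hij x y
    have := two_mul_zero_le_of_convexOn (hg.edge_convex i j hij) x y
    rw [hc.edge_eq i j hij x y, hc.edge_eq i j hij (-x) (-y)] at this
    linarith
  have hP : ∀ i j, 0 ≤ P i j := fun i j => by
    by_cases hij : G.Adj i j
    · simpa using hform i j hij 1 0
    · exact (hc.quad_eq_zero i j hij).ge
  have hdet : ∀ i j, offDiag Γ i j ^ 2 ≤ P i j * P j i := fun i j => by
    by_cases hij : G.Adj i j
    · have := discrim_le_zero (a := P i j) (b := 2 * Γ i j) (c := P j i) fun x => by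
        simpa using hform i j hij x 1
      rw [discrim] at this
      rw [offDiag, if_neg hij.ne]
      linarith
    · have h0 : offDiag Γ i j = 0 := by
        unfold offDiag
        split_ifs with h
        · rfl
        · exact hc.matrix_eq_zero i j h hij
      rw [h0]
      simpa using mul_nonneg (hP i j) (hP j i)
  obtain ⟨ε, hε, hε0⟩ : ∃ ε : ℝ,
      (∀ i, Fintype.card V * ε < quadCoeff (g.node i)) ∧ 0 < ε := by
    have h1 : ∀ᶠ ε : ℝ in 𝓝[>] 0, ∀ i, Fintype.card V * ε < quadCoeff (g.node i) := by
      rw [eventually_all]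
      intro i
      have : Tendsto (fun ε : ℝ => Fintype.card V * ε) (𝓝[>] 0) (𝓝 (Fintype.card V * 0)) :=
        (tendsto_id.const_mul _).mono_left nhdsWithin_le_nhds
      refine this.eventually (gt_mem_nhds ?_)
      simpa using quadCoeff_pos_of_strictConvexOn (hg.node_strictConvex i)
    exact (h1.and self_mem_nhdsWithin).exists
  replace hε0 : 0 < ε := hε0
  -- Convexity of the edge components gives only weak inequalities. Adding `ε` to every share,
  -- non-edges and diagonal included, makes them strict; the strictly convex vertex components pay
  -- for it.
  refine ⟨fun i j => P i j + ε, ⟨fun i j => ?_, fun i => if_pos rfl,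
    fun i j => by linarith [hP i j], fun i j => ?_, fun i => ?_⟩, fun i j => by linarith⟩
  · simp only [offDiag, eq_comm (a := i), hΓ.apply i j]
  · nlinarith [hdet i j, mul_pos hε0 hε0, mul_nonneg hε0.le (hP i j), mul_nonneg hε0.le (hP j i)]
  · simp only [hc.diag_eq i, Finset.sum_add_distrib, Finset.sum_const, Finset.card_univ,
      nsmul_eq_mul]
    linarith [hε i]

/-! ### Messages in normalized coefficients -/

variable {F : Components V} {S m : V → ℝ} {P d : V → V → ℝ}

/-- Messages with curvatures `a` and slopes `b`, up to the parts of the edge components that depend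
on the receiving vertex alone. -/
structure HasMessageCoeffs (G : SimpleGraph V) (P d : V → V → ℝ) (J : V → V → ℝ → ℝ)
    (a b : V → V → ℝ) : Prop where
  curvature_eq_zero : ∀ i j, ¬G.Adj i j → a i j = 0
  slope_eq_zero : ∀ i j, ¬G.Adj i j → b i j = 0
  eq_add : ∀ i j, G.Adj i j → ∀ x,
    J i j x = (a i j + P j i) / 2 * x ^ 2 + (b i j + d j i) * x + J i j 0

namespace HasMessageCoeffs

variable {J : V → V → ℝ → ℝ} {a b : V → V → ℝ}

omit [DecidableEq V] [DecidableRel G.Adj] in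
lemma sum_subset (hF : HasCoeffs G Γ h F S m P d) (hJ : HasMessageCoeffs G P d J a b) (i : V)
    {s s' : Finset V} (hs : s ⊆ s') (hadj : ∀ u ∈ s, G.Adj i u)
    (hadj' : ∀ u ∈ s', G.Adj i u → u ∈ s) (y : ℝ) :
    ∑ u ∈ s, J u i y = (∑ u ∈ s', a u i + ∑ u ∈ s', P i u) / 2 * y ^ 2
      + (∑ u ∈ s', b u i + ∑ u ∈ s', d i u) * y + ∑ u ∈ s, J u i 0 := by
  have hsub : ∀ f : V → ℝ, (∀ u, ¬G.Adj i u → f u = 0) → ∑ u ∈ s', f u = ∑ u ∈ s, f u :=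
    fun f hf => (Finset.sum_subset hs fun u hu hus => hf u fun h => hus (hadj' u hu h)).symm
  rw [hsub _ fun u hu => hJ.curvature_eq_zero u i fun h => hu h.symm,
    hsub _ fun u hu => hJ.slope_eq_zero u i fun h => hu h.symm,
    hsub _ (hF.quad_eq_zero i), hsub _ (hF.lin_eq_zero i)]
  simp only [← Finset.sum_add_distrib, Finset.sum_div, Finset.sum_mul]
  exact Finset.sum_congr rfl fun u hu => hJ.eq_add u i (hadj u hu).symm y

/-- The shares contained in the incoming messages, the edge `{i, j}` and the vertex `i` add up to `Γ
i i`, so the choice of decomposition drops out of the curvature and the slope in `y`. -/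
lemma messageObjective_eq (hF : HasCoeffs G Γ h F S m P d) (hJ : HasMessageCoeffs G P d J a b)
    {i j : V} (hij : G.Adj i j) (x y : ℝ) :
    messageObjective G F J i j x y = curvature (fun i => Γ i i) a i j / 2 * y ^ 2
      + (offDiag Γ i j * x + (∑ u ∈ Finset.univ.erase j, b u i - h i)) * y
      + (P j i / 2 * x ^ 2 + d j i * x + messageObjective G F J i j 0 0) := by
  have hsum := hJ.sum_subset hF i (Finset.erase_subset_erase j
    (Finset.subset_univ (G.neighborFinset i))) (by simp) (by simp +contextual) y
  have hD := hF.diag_eq i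
  have hm := hF.field_eq i
  rw [← Finset.add_sum_erase _ _ (Finset.mem_univ j)] at hD hm
  have h0 : messageObjective G F J i j 0 0 = F.node i 0 + F.edge i j 0 0
      + ∑ u ∈ (G.neighborFinset i).erase j, J u i 0 := rfl
  rw [h0, messageObjective, hsum, hF.node_eq i y, hF.edge_eq i j hij y x, curvature, offDiag,
    if_neg hij.ne, hD]
  have hm' : m i = -h i - d i j - ∑ u ∈ Finset.univ.erase j, d i u := by linarith
  rw [hm']
  ring

omit [DecidableEq V] in
lemma localObjective_eq (hF : HasCoeffs G Γ h F S m P d) (hJ : HasMessageCoeffs G P d J a b)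
    (j : V) (y : ℝ) :
    localObjective G F J j y = (Γ j j + ∑ i, a i j) / 2 * y ^ 2 + (∑ i, b i j - h j) * y
      + localObjective G F J j 0 := by
  have hsum := hJ.sum_subset hF j (Finset.subset_univ (G.neighborFinset j)) (by simp) (by simp) y
  have hm' : m j = -h j - ∑ u, d j u := by linarith [hF.field_eq j]
  have h0 : localObjective G F J j 0 = F.node j 0 + ∑ u ∈ G.neighborFinset j, J u j 0 := rfl
  rw [h0, localObjective, hsum, hF.node_eq j y, hF.diag_eq j, hm']
  ring

lemma step (hF : HasCoeffs G Γ h F S m P d) (hJ : HasMessageCoeffs G P d J a b)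
    (hK : ∀ i j, 0 < curvature (fun i => Γ i i) a i j) (κ : V → V → ℝ) :
    HasMessageCoeffs G P d
      (fun i j x => κ i j + ⨅ y : ℝ, messageObjective G F J i j x y)
      (curvatureStep (offDiag Γ) (fun i => Γ i i) a)
      (slopeStep (offDiag Γ) (fun i => Γ i i) h a b) := by
  have hoff : ∀ i j, ¬G.Adj i j → offDiag Γ i j = 0 := fun i j hij => by
    unfold offDiag
    split_ifs with h
    · rfl
    · exact hF.matrix_eq_zero i j h hij
  refine ⟨fun i j hij => by simp [curvatureStep, hoff i j hij],
    fun i j hij => by simp [slopeStep, hoff i j hij], fun i j hij x => ?_⟩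
  -- Expressing the constant through the value at 0 makes the offset cancel.
  rw [iInf_quadratic (hK i j) (hJ.messageObjective_eq hF hij x),
    iInf_quadratic (hK i j) (hJ.messageObjective_eq hF hij 0), curvatureStep, slopeStep]
  have := (hK i j).ne'
  field_simp
  ring

end HasMessageCoeffs

omit [DecidableEq V] in
lemma objective_le_of_mulVec_eq (hΓ : Γ.PosDef) {x₀ : V → ℝ} (hx₀ : Γ.mulVec x₀ = h)
    (x : V → ℝ) : objective Γ h x₀ ≤ objective Γ h x := by
  have h1 := hΓ.posSemidef.dotProduct_mulVec_nonneg (x - x₀)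
  have hsymm : x₀ ⬝ᵥ Γ.mulVec x = x ⬝ᵥ Γ.mulVec x₀ := by
    have : Γ.IsSymm := by simpa using hΓ.isHermitian
    rw [Matrix.dotProduct_mulVec, ← Matrix.mulVec_transpose, this.eq, dotProduct_comm]
  simp only [star_trivial, Matrix.mulVec_sub, sub_dotProduct, dotProduct_sub, hsymm] at h1
  unfold objective
  rw [hx₀] at h1 ⊢
  rw [dotProduct_comm h x₀, dotProduct_comm h x]
  linarith

end Graph

end MinSum

/-! ### Convergence of the estimates -/

namespace MinSum

section Graph

variable {V : Type*} [Fintype V] [DecidableEq V] {G : SimpleGraph V} [DecidableRel G.Adj]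
  {Γ : Matrix V V ℝ} {h : V → ℝ} {F : Components V} {S m : V → ℝ} {P d p : V → V → ℝ}

omit [Fintype V] [DecidableEq V] in
/-- Quadratic messages have coefficients relative to the components. -/
lemma HasMessageCoeffs.exists_of_isQuadratic {J : V → V → ℝ → ℝ}
    (hJ : ∀ i j, G.Adj i j → IsQuadratic (J i j)) (P d : V → V → ℝ) :
    ∃ a b, HasMessageCoeffs G P d J a b ∧ ∀ i j, G.Adj i j → a i j = quadCoeff (J i j) - P j i := by
  refine ⟨fun i j => if G.Adj i j then quadCoeff (J i j) - P j i else 0,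
    fun i j => if G.Adj i j then linCoeff (J i j) - d j i else 0,
    ⟨fun i j hij => if_neg hij, fun i j hij => if_neg hij, fun i j hij x => ?_⟩,
    fun i j hij => if_pos hij⟩
  rw [if_pos hij, if_pos hij, sub_add_cancel, sub_add_cancel]
  exact (hJ i j hij).eq_coeff x

/-- Quadratic messages stay quadratic, and their coefficients follow the updates
`curvatureStep` and `slopeStep`. -/
lemma exists_message_coeffs (hF : HasCoeffs G Γ h F S m P d)
    (H : IsSplit (offDiag Γ) (fun i => Γ i i) p) {J₀ : V → V → ℝ → ℝ} {a₀ b₀ : V → V → ℝ}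
    (hJ₀ : HasMessageCoeffs G P d J₀ a₀ b₀) (ha₀ : ∀ i j, -p j i ≤ a₀ i j)
    (κ : ℕ → V → V → ℝ) :
    ∃ a b : ℕ → V → V → ℝ, (∀ t i j, -p j i ≤ a t i j) ∧
      (∀ t i j, a (t + 1) i j = curvatureStep (offDiag Γ) (fun i => Γ i i) (a t) i j) ∧
      (∀ t i j, b (t + 1) i j = slopeStep (offDiag Γ) (fun i => Γ i i) h (a t) (b t) i j) ∧
      ∀ t, HasMessageCoeffs G P d (message G F J₀ κ t) (a t) (b t) := by
  let a : ℕ → V → V → ℝ := fun t =>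
    Nat.rec a₀ (fun _ a => curvatureStep (offDiag Γ) (fun i => Γ i i) a) t
  let b : ℕ → V → V → ℝ := fun t =>
    Nat.rec b₀ (fun s b => slopeStep (offDiag Γ) (fun i => Γ i i) h (a s) b) t
  have hlb : ∀ t i j, -p j i ≤ a t i j := by
    intro t
    induction t with
    | zero => exact ha₀
    | succ t ih => exact fun i j => (H.lt_curvatureStep ih i j).le
  refine ⟨a, b, hlb, fun _ _ _ => rfl, fun _ _ _ => rfl, fun t => ?_⟩
  induction t with
  | zero => exact hJ₀
  | succ t ih => exact ih.step hF (H.curvature_pos (hlb t)) (κ t)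

omit [DecidableEq V] in
lemma diag_add_sum_pos {C : V → V → ℝ} {D : V → ℝ} (H : IsSplit C D p) {a : V → V → ℝ}
    (ha : ∀ i j, -p j i ≤ a i j) (j : V) : 0 < D j + ∑ i, a i j := by
  have h1 : -∑ i, p j i ≤ ∑ i, a i j := by
    rw [← Finset.sum_neg_distrib]
    exact Finset.sum_le_sum fun i _ => ha i j
  linarith [H.sum_lt j]

lemma diag_mul_add_sum_offDiag_mul (Γ : Matrix V V ℝ) (x : V → ℝ) (i : V) :
    Γ i i * x i + ∑ j, offDiag Γ i j * x j = Γ.mulVec x i := by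
  rw [Matrix.mulVec, dotProduct, ← Finset.add_sum_erase _ _ (Finset.mem_univ i),
    ← Finset.add_sum_erase _ (fun j => Γ i j * x j) (Finset.mem_univ i)]
  rw [offDiag, if_pos rfl, zero_mul, zero_add]
  congr 1
  refine Finset.sum_congr rfl fun j hj => ?_
  rw [offDiag, if_neg (Finset.ne_of_mem_erase hj).symm]

/-- The minimizers of the local objectives converge to the solution of the linear system. -/
lemma tendsto_estimate {C : V → V → ℝ} {D h x₀ : V → ℝ} (H : IsSplit C D p)
    (hx₀ : ∀ i, D i * x₀ i + ∑ j, C i j * x₀ j = h i) {a b : ℕ → V → V → ℝ}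
    (ha₀ : ∀ i j, -p j i ≤ a 0 i j) (ha : ∀ t i j, a (t + 1) i j = curvatureStep C D (a t) i j)
    (hb : ∀ t i j, b (t + 1) i j = slopeStep C D h (a t) (b t) i j) :
    Tendsto (fun t j => -(∑ i, b t i j - h j) / (D j + ∑ i, a t i j)) atTop (𝓝 x₀) := by
  obtain ⟨a', ha', hat, hbt⟩ := H.tendsto_slope hx₀ ha₀ ha hb
  rw [tendsto_pi_nhds]
  intro j
  have hpos := diag_add_sum_pos H (fun i j => (ha' i j).le) j
  -- With the limiting slopes the contributions of `a'` cancel and row `j` of the linear system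
  -- remains.
  have hval : x₀ j = -(∑ i, (C i j * x₀ i - a' i j * x₀ j) - h j) / (D j + ∑ i, a' i j) := by
    rw [eq_div_iff hpos.ne', Finset.sum_sub_distrib, ← Finset.sum_mul, ← hx₀ j]
    simp only [H.symm _ j]
    ring
  rw [hval]
  exact ((tendsto_finsetSum _ fun i _ => hbt i j).sub_const _).neg.div
    (tendsto_const_nhds.add (tendsto_finsetSum _ fun i _ => hat i j)) hpos.ne'

end Graph

end MinSum

theorem corollary1 {V : Type*} [Fintype V] [DecidableEq V]
    (G : SimpleGraph V) [DecidableRel G.Adj]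
    (Γ : Matrix V V ℝ) (hΓ : Γ.PosDef) (h : V → ℝ)
    (g : MinSum.Components V)
    (hg : MinSum.IsConvexDecomposition G (MinSum.objective Γ h) g)
    (F : MinSum.Components V)
    (hF : MinSum.IsQuadraticDecomposition G (MinSum.objective Γ h) F)
    (J₀ : V → V → ℝ → ℝ)
    (hJ₀ : ∀ i j, G.Adj i j → MinSum.IsQuadratic (J₀ i j))
    (hconv : ∀ i j, G.Adj i j → ConvexOn ℝ Set.univ (fun p : ℝ × ℝ =>
      g.edge i j p.1 p.2 + J₀ i j p.2 + J₀ j i p.1 - F.edge i j p.1 p.2))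
    (κ : ℕ → V → V → ℝ) :
    -- every minimization in the message updates is well posed
    (∀ t i j, G.Adj i j → ∀ xj : ℝ, ∃ yi : ℝ,
      IsMinOn (MinSum.messageObjective G F (MinSum.message G F J₀ κ t) i j xj) Set.univ yi) ∧
    -- the running estimates are well defined, they converge, and their values tend to the minimum
    ∃ x : ℕ → V → ℝ,
      (∀ t j y,
        IsMinOn (MinSum.localObjective G F (MinSum.message G F J₀ κ t) j) Set.univ y ↔
          y = x t j) ∧
      (∃ xlim : V → ℝ, Tendsto x atTop (𝓝 xlim)) ∧
      ∃ m : ℝ, IsLeast (Set.range (MinSum.objective Γ h)) m ∧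
        Tendsto (fun t => MinSum.objective Γ h (x t)) atTop (𝓝 m) := by
  have hsymm : Γ.IsSymm := by simpa using hΓ.isHermitian
  obtain ⟨mg, P, dg, hgc⟩ := hg.toIsQuadraticDecomposition.exists_hasCoeffs hsymm
  obtain ⟨mF, Q, dF, hFc⟩ := hF.exists_hasCoeffs hsymm
  obtain ⟨p, H, hp⟩ := hg.exists_isSplit hsymm hgc
  obtain ⟨a₀, b₀, hc₀, ha₀⟩ := MinSum.HasMessageCoeffs.exists_of_isQuadratic hJ₀ Q dF
  have hlb₀ : ∀ i j, -p j i ≤ a₀ i j := fun i j => by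
    by_cases hij : G.Adj i j
    -- Convexity is needed only along the receiver's axis: the points `(0, ±1)` give `P j i +
    -- quadCoeff (J₀ i j) - Q j i ≥ 0`, while `J₀ j i` contributes a constant that cancels.
    · have h1 := MinSum.two_mul_zero_le_of_convexOn (φ := fun x y =>
        g.edge i j x y + J₀ i j y + J₀ j i x - F.edge i j x y) (hconv i j hij) 0 1
      have h2 := hgc.edge_eq i j hij 0
      have h3 := hFc.edge_eq i j hij 0
      simp only [neg_zero] at h1
      rw [h2 1, h2 (-1), h3 1, h3 (-1)] at h1
      rw [ha₀ i j hij, MinSum.quadCoeff]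
      linarith [hp j i]
    · rw [hc₀.curvature_eq_zero i j hij]
      linarith [H.pos j i]
  obtain ⟨a, b, hlb, ha, hb, hmsg⟩ := MinSum.exists_message_coeffs hFc H hc₀ hlb₀ κ
  have hx₀ : Γ.mulVec (Γ⁻¹.mulVec h) = h := by
    rw [Matrix.mulVec_mulVec, Matrix.mul_nonsing_inv _
      ((Matrix.isUnit_iff_isUnit_det _).1 hΓ.isUnit),
      Matrix.one_mulVec]
  have hlim := MinSum.tendsto_estimate H (h := h) (x₀ := Γ⁻¹.mulVec h)
    (fun i => by rw [MinSum.diag_mul_add_sum_offDiag_mul, hx₀]) (hlb 0) ha hb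
  refine ⟨fun t i j hij xj => ⟨_, (MinSum.isMinOn_quadratic_iff (H.curvature_pos (hlb t) i j)
    ((hmsg t).messageObjective_eq hFc hij xj) _).2 rfl⟩, _, fun t j y =>
    MinSum.isMinOn_quadratic_iff (MinSum.diag_add_sum_pos H (hlb t) j)
      ((hmsg t).localObjective_eq hFc j) y, ⟨_, hlim⟩, MinSum.objective Γ h (Γ⁻¹.mulVec h),
    ⟨⟨_, rfl⟩, ?_⟩, ?_⟩
  · rintro _ ⟨x, rfl⟩
    exact MinSum.objective_le_of_mulVec_eq hΓ hx₀ x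
  · have hcont : Continuous (MinSum.objective Γ h) := by
      unfold MinSum.objective dotProduct Matrix.mulVec dotProduct
      fun_prop
    exact (hcont.tendsto _).comp hlim
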